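/- A rewiring map on $[n]=\{1,\dots,n\}$ is a symmetric $n\times n$ array with entries in $\{0,1\}\times\{0,1\}$ and all diagonal entries equal to $(0,0)$; $\mathcal W_n$ is the set of these, $\mathcal W^*=\bigcup_{n\ge1}\mathcal W_n$, and $\mathcal W_\infty$ is the space of infinite rewiring maps (symmetric arrays $(w_{ij})_{i,j\ge1}$ of the same kind) with the product $\sigma$-field. Write $w|_{[n]}$ for the restriction $(w_{ij})_{i,j\le n}$ and $w^{\psi}=(w_{\psi(i)\psi(j)})_{i,j}$. For $V\in\mathcal W_m$ and $W\in\mathcal W_n$, $m\le n$, the density $t(V,W)$ is the number of injections $\psi:[m]\to[n]$ with $W^\psi=V$, divided by $n(n-1)\cdots(n-m+1)$. The rewiring limit of $w\in\mathcal W_\infty$ is $|w|=(t(V,w))_{V\in\mathcal W^*}\in[0,1]^{\mathcal W^*}$, where $t(V,w)=\lim_{n\to\infty}t(V,w|_{[n]})$, provided that all these limits exist. The space of rewiring limits $\mathcal L\subset[0,1]^{\mathcal W^*}$ is the set of all $|w|$ that arise in this way, with the subspace topology of the product topology and its Borel $\sigma$-field. For $\upsilon\in\mathcal L$, the rewiring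 measure $\Omega_\upsilon$ is the unique probability measure on $\mathcal W_\infty$ with $\Omega_\upsilon(\{w: w|_{[n]}=V\})=\upsilon(V)$ for all $n\ge1$ and $V\in\mathcal W_n$. For a measure $\Upsilon$ on $\mathcal L$ put $\Omega_\Upsilon(\cdot)=\int_{\mathcal L}\Omega_\upsilon(\cdot)\,\Upsilon(\mathrm d\upsilon)$. A random rewiring map $W$ with values in $\mathcal W_\infty$ is exchangeable if $W^\sigma$ has the same law as $W$ for every permutation $\sigma$ of $\{1,2,\dots\}$ that moves only finitely many points. **Corollary.** The space $\mathcal L$ of rewiring limits is compact, and to any exchangeable random rewiring map $W$ with values in $\mathcal W_\infty$ there exists a unique probability measure $\Upsilon$ on $\mathcal L$ such that $W\sim\Omega_\Upsilon$. -/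

import Mathlib

open MeasureTheory Filter Topology

/-- A rewiring map on the vertex set `ι`: a symmetric array with entries in `{0,1} × {0,1}` whose
diagonal entries are all `(0,0)`. The set `𝒲ₙ` is `RewiringMap (Fin n)` and the space of infinite
rewiring maps is `RewiringMap ℕ` (vertices are numbered from `0`). It carries the topology and the
σ-algebra inherited from the product of the discrete spaces `{0,1} × {0,1}`. -/
abbrev RewiringMap (ι : Type) : Type :=
  {w : ι → ι → Bool × Bool // (∀ i j, w i j = w j i) ∧ ∀ i, w i i = (false, false)}

namespace RewiringMap

/-- The array `w^f = (w_{f(i) f(j)})_{i,j}`. -/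
def comap {ι κ : Type} (f : κ → ι) (w : RewiringMap ι) : RewiringMap κ :=
  ⟨fun i j => w.1 (f i) (f j), fun i j => w.2.1 (f i) (f j), fun i => w.2.2 (f i)⟩

/-- The restriction `w|_[n]` of an infinite rewiring map to the first `n` vertices. -/
def restrict (n : ℕ) (w : RewiringMap ℕ) : RewiringMap (Fin n) :=
  comap (fun i : Fin n => (i : ℕ)) w

/-- `ind(V, W)`: the number of injections `ψ : [m] → [n]` with `W^ψ = V`. -/
noncomputable def ind {m n : ℕ} (V : RewiringMap (Fin m)) (W : RewiringMap (Fin n)) : ℕ :=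
  Nat.card {ψ : Fin m ↪ Fin n // comap ψ W = V}

/-- The density `t(V, W) = ind(V, W) / (n (n - 1) ⋯ (n - m + 1))`. -/
noncomputable def density {m n : ℕ} (V : RewiringMap (Fin m)) (W : RewiringMap (Fin n)) : ℝ :=
  (ind V W : ℝ) / (n.descFactorial m : ℝ)

end RewiringMap

/-- The countable set `𝒲* = ⋃_{n ≥ 1} 𝒲ₙ` of all finite rewiring maps. -/
abbrev FiniteRewiringMap : Type := Σ n : ℕ+, RewiringMap (Fin n)

/-- `υ` is the rewiring limit `|w|` of `w`: for every finite rewiring map `V`, the limiting density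
`t(V, w) = lim_n t(V, w|_[n])` exists and equals `υ V`. -/
def IsRewiringLimit (w : RewiringMap ℕ) (υ : FiniteRewiringMap → Set.Icc (0 : ℝ) 1) : Prop :=
  ∀ V : FiniteRewiringMap,
    Tendsto (fun n : ℕ => RewiringMap.density V.2 (w.restrict n)) atTop (𝓝 (υ V : ℝ))

/-- The space of rewiring limits, as a subspace of the product space `[0,1]^𝒲*`, with the
subspace topology and the trace of the product (Borel) σ-algebra. -/
abbrev RewiringLimits : Type :=
  {υ : FiniteRewiringMap → Set.Icc (0 : ℝ) 1 // ∃ w : RewiringMap ℕ, IsRewiringLimit w υ}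

namespace RewiringMap

/-- The cylinder set `{w : w|_[n] = V}` of infinite rewiring maps. -/
def cylinder (V : FiniteRewiringMap) : Set (RewiringMap ℕ) := {w | w.restrict V.1 = V.2}

theorem continuous_restrict (n : ℕ) : Continuous (restrict n) := by
  refine Continuous.subtype_mk (continuous_pi fun i => continuous_pi fun j => ?_) _
  exact (continuous_apply_apply (i : ℕ) (j : ℕ)).comp continuous_subtype_val

theorem isClopen_cylinder (V : FiniteRewiringMap) : IsClopen (cylinder V) :=
  (isClopen_discrete {V.2}).preimage (continuous_restrict _)

theorem measurableSet_cylinder (V : FiniteRewiringMap) : MeasurableSet (cylinder V) :=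
  (isClopen_cylinder V).isOpen.measurableSet

instance : BorelSpace (RewiringMap ℕ) := Subtype.borelSpace _

instance : TopologicalSpace.MetrizableSpace (RewiringMap ℕ) :=
  Topology.IsEmbedding.subtypeVal.metrizableSpace

instance : CompactSpace (RewiringMap ℕ) := by
  refine isCompact_iff_compactSpace.1 (IsClosed.isCompact ?_)
  have h : IsClosed ((⋂ i, ⋂ j, {w : ℕ → ℕ → Bool × Bool | w i j = w j i}) ∩
      ⋂ i, {w : ℕ → ℕ → Bool × Bool | w i i = (false, false)}) := by
    refine IsClosed.inter (isClosed_iInter fun i => isClosed_iInter fun j => ?_)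
      (isClosed_iInter fun i => ?_)
    · exact isClosed_eq (by fun_prop) (by fun_prop)
    · exact isClosed_eq (by fun_prop) (by fun_prop)
  refine (congrArg IsClosed (Set.ext fun w => ?_)).mpr h
  simp only [Set.mem_inter_iff, Set.mem_iInter]
  rfl

end RewiringMap


namespace RewiringMap

theorem card_perm_eq {m n : ℕ} (h : m ≤ n) (P : (Fin m ↪ Fin n) → Prop) :
    Nat.card {σ : Equiv.Perm (Fin n) // P ((Fin.castLEEmb h).trans σ.toEmbedding)} *
      n.descFactorial m = n.factorial * Nat.card {ψ : Fin m ↪ Fin n // P ψ} := by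
  classical
  let Φ : Equiv.Perm (Fin n) → (Fin m ↪ Fin n) := fun σ => (Fin.castLEEmb h).trans σ.toEmbedding
  let c := (Finset.univ.filter fun σ => Φ σ = Fin.castLEEmb h).card
  have hfib : ∀ ψ, (Finset.univ.filter fun σ => Φ σ = ψ).card = c := by
    intro ψ
    obtain ⟨τ, hτ⟩ := Equiv.Perm.exists_extending_pair (Fin.castLEEmb h) ψ
      (Fin.castLEEmb h).injective ψ.injective
    refine (Finset.card_bij (fun σ _ => τ * σ) ?_ ?_ ?_).symm
    · intro σ hσ
      simp only [Finset.mem_filter, Finset.mem_univ, true_and] at hσ ⊢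
      ext i
      have := DFunLike.congr_fun hσ i
      simp only [Φ, Function.Embedding.trans_apply, Equiv.coe_toEmbedding] at this ⊢
      rw [Equiv.Perm.mul_apply, this, hτ]
    · intro a _ b _ hab
      exact mul_left_cancel hab
    · intro σ hσ
      refine ⟨τ⁻¹ * σ, ?_, by simp⟩
      simp only [Finset.mem_filter, Finset.mem_univ, true_and] at hσ ⊢
      ext i
      have := DFunLike.congr_fun hσ i
      simp only [Φ, Function.Embedding.trans_apply, Equiv.coe_toEmbedding] at this ⊢
      rw [Equiv.Perm.mul_apply, this, ← hτ]
      exact congrArg _ (τ.symm_apply_apply _)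
  have key : ∀ Q : (Fin m ↪ Fin n) → Prop,
      Nat.card {σ : Equiv.Perm (Fin n) // Q (Φ σ)} = Nat.card {ψ // Q ψ} * c := by
    intro Q
    rw [Nat.card_eq_fintype_card, Nat.card_eq_fintype_card, Fintype.card_subtype,
      Fintype.card_subtype,
      Finset.card_eq_sum_card_fiberwise (f := Φ) (t := Finset.univ.filter Q)]
    · rw [Finset.sum_const_nat (m := c)]
      intro ψ hψ
      rw [← hfib ψ, Finset.filter_filter]
      congr 1
      ext σ
      simp only [Finset.mem_filter, Finset.mem_univ, true_and] at hψ ⊢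
      constructor
      · exact fun h => h.2
      · rintro rfl; exact ⟨hψ, rfl⟩
    · intro σ hσ
      simpa using hσ
  have h1 := key P
  have h2 := key fun _ => True
  simp only [Nat.card_eq_fintype_card, Fintype.card_subtype_true, Fintype.card_perm,
    Fintype.card_fin, Fintype.card_embedding_eq] at h2
  rw [h1, h2]
  ring

/-- A permutation of `[n]`, read as a map of `ℕ`. -/
def extendPerm {n : ℕ} (σ : Equiv.Perm (Fin n)) (i : ℕ) : ℕ :=
  if h : i < n then (σ ⟨i, h⟩ : ℕ) else 0

theorem exists_measure_cylinder (υ : RewiringLimits) :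
    ∃ μ : Measure (RewiringMap ℕ), IsProbabilityMeasure μ ∧
      ∀ V : FiniteRewiringMap, μ (cylinder V) = ENNReal.ofReal (υ.1 V : ℝ) := by
  obtain ⟨υ, w, hw⟩ := υ
  let g : (n : ℕ) → Equiv.Perm (Fin n) → RewiringMap ℕ := fun n σ => comap (extendPerm σ) w
  let μs : ℕ → ProbabilityMeasure (RewiringMap ℕ) := fun n =>
    ⟨((PMF.uniformOfFintype (Equiv.Perm (Fin n))).map (g n)).toMeasure, inferInstance⟩
  have hμs : ∀ V : FiniteRewiringMap, Tendsto (fun n => ((μs n (cylinder V) : NNReal) : ℝ)) atTop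
      (𝓝 (υ V : ℝ)) := by
    intro V
    refine (hw V).congr' ?_
    filter_upwards [eventually_ge_atTop (V.1 : ℕ)] with n hn
    have hset : ∀ σ : Equiv.Perm (Fin n), g n σ ∈ cylinder V ↔
        comap ((Fin.castLEEmb hn).trans σ.toEmbedding) (w.restrict n) = V.2 := by
      intro σ
      have : (g n σ).restrict V.1 =
          comap ((Fin.castLEEmb hn).trans σ.toEmbedding) (w.restrict n) := by
        ext i j <;> simp [g, restrict, comap, extendPerm, i.2.trans_le hn, j.2.trans_le hn] <;> rfl
      rw [cylinder, Set.mem_ofPred_eq, this]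
    have hc := card_perm_eq hn fun ψ => comap ψ (w.restrict n) = V.2
    have hm : ((μs n (cylinder V) : NNReal) : ℝ) =
        (Nat.card {σ : Equiv.Perm (Fin n) //
          comap ((Fin.castLEEmb hn).trans σ.toEmbedding) (w.restrict n) = V.2} : ℝ) /
          n.factorial := by
      classical
      have : (μs n : Measure (RewiringMap ℕ)) (cylinder V) =
          ((Nat.card {σ : Equiv.Perm (Fin n) //
          comap ((Fin.castLEEmb hn).trans σ.toEmbedding) (w.restrict n) = V.2} : ℕ) : ENNReal) /
          (n.factorial : ℕ) := by
        let _ : MeasurableSpace (Equiv.Perm (Fin n)) := ⊤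
        change (PMF.map (g n) (PMF.uniformOfFintype _)).toMeasure _ = _
        rw [PMF.toMeasure_map_apply _ _ _ measurable_from_top (measurableSet_cylinder V),
          PMF.toMeasure_uniformOfFintype_apply _ (by trivial), Nat.card_eq_fintype_card,
          Fintype.card_perm, Fintype.card_fin]
        congr 2
        exact Fintype.card_congr (Equiv.subtypeEquivRight hset)
      rw [← ProbabilityMeasure.measureReal_eq_coe_coeFn, Measure.real, this]
      simp
    rw [hm, density, ind, div_eq_div_iff]
    · rw [mul_comm]; exact_mod_cast hc.symm
    · exact_mod_cast (Nat.descFactorial_pos.2 hn).ne'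
    · exact_mod_cast n.factorial_ne_zero
  let _ := TopologicalSpace.metrizableSpaceMetric (RewiringMap ℕ)
  obtain ⟨μ, -, hμ⟩ := isCompact_univ.exists_mapClusterPt (f := (atTop : Filter ℕ)) (u := μs)
    (by simp)
  obtain ⟨F, hF, hlim⟩ := mapClusterPt_iff_ultrafilter.1 hμ
  refine ⟨μ, inferInstance, fun V => ?_⟩
  have h1 := ProbabilityMeasure.tendsto_measure_of_isClopen_of_tendsto hlim (isClopen_cylinder V)
  have h2 := tendsto_nhds_unique ((NNReal.continuous_coe.tendsto _).comp h1) ((hμs V).mono_left hF)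
  rw [← h2]
  simp

/-- The cylinder sets. -/
def cylinders : Set (Set (RewiringMap ℕ)) := {s | s = ∅ ∨ ∃ V, s = cylinder V}

theorem isPiSystem_cylinders : IsPiSystem cylinders := by
  have key : ∀ V V' : FiniteRewiringMap, (V.1 : ℕ) ≤ V'.1 → (cylinder V ∩ cylinder V').Nonempty →
      cylinder V ∩ cylinder V' = cylinder V' := by
    rintro V V' h ⟨w, hw, hw'⟩
    refine Set.inter_eq_right.2 fun u hu => ?_
    simp only [cylinder, Set.mem_ofPred_eq] at hw hw' hu ⊢
    rw [← hw]
    have h0 : u.restrict V'.1 = w.restrict V'.1 := hu.trans hw'.symm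
    have := congrArg (comap (Fin.castLE h)) h0
    exact this
  rintro s (rfl | ⟨V, rfl⟩) t (rfl | ⟨V', rfl⟩) hst
  · simp at hst
  · simp at hst
  · simp at hst
  · refine Or.inr ?_
    rcases le_total (V.1 : ℕ) V'.1 with h | h
    · exact ⟨V', key V V' h hst⟩
    · exact ⟨V, by rw [Set.inter_comm] at hst ⊢; exact key V' V h hst⟩

theorem generateFrom_cylinders :
    (inferInstance : MeasurableSpace (RewiringMap ℕ)) = .generateFrom cylinders := by
  apply le_antisymm
  · have hmeas : ∀ i j : ℕ, @Measurable _ _ (.generateFrom cylinders) _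
        (fun w : RewiringMap ℕ => w.1 i j) := by
      intro i j
      let N : ℕ+ := ⟨max i j + 1, Nat.succ_pos _⟩
      let i' : Fin N := ⟨i, Nat.lt_succ_of_le (le_max_left i j)⟩
      let j' : Fin N := ⟨j, Nat.lt_succ_of_le (le_max_right i j)⟩
      have h1 : @Measurable _ _ (.generateFrom cylinders) ⊤
          (restrict N : RewiringMap ℕ → RewiringMap (Fin N)) := by
        let _ : MeasurableSpace (RewiringMap ℕ) := .generateFrom cylinders
        refine @measurable_to_countable' _ _ ⊤ _ _ _ fun V => ?_
        exact MeasurableSpace.measurableSet_generateFrom (Or.inr ⟨⟨N, V⟩, rfl⟩)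
      have h2 : @Measurable _ _ ⊤ _ (fun V : RewiringMap (Fin N) => V.1 i' j') :=
        measurable_from_top
      exact @Measurable.comp _ _ _ (.generateFrom cylinders) ⊤ _ _ _ h2 h1
    rintro s ⟨t, ht, rfl⟩
    have hval : @Measurable _ _ (.generateFrom cylinders) _
        (fun w : RewiringMap ℕ => w.1) :=
      @measurable_pi_lambda _ _ _ (_) _ _ fun i => @measurable_pi_lambda _ _ _ (_) _ _ fun j =>
        hmeas i j
    exact hval ht
  · refine MeasurableSpace.generateFrom_le ?_
    rintro s (rfl | ⟨V, rfl⟩)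
    · exact MeasurableSet.empty
    · exact measurableSet_cylinder V

end RewiringMap

/-- The rewiring measure `Ω_υ` directed by `υ`: the unique probability measure on the space of
infinite rewiring maps such that `Ω_υ {w : w|_[n] = V} = υ(V)` for all `n ≥ 1` and `V ∈ 𝒲ₙ`. -/
noncomputable def rewiringMeasure (υ : RewiringLimits) : Measure (RewiringMap ℕ) :=
  (RewiringMap.exists_measure_cylinder υ).choose

instance (υ : RewiringLimits) : IsProbabilityMeasure (rewiringMeasure υ) :=
  (RewiringMap.exists_measure_cylinder υ).choose_spec.1

theorem rewiringMeasure_cylinder (υ : RewiringLimits) (V : FiniteRewiringMap) :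
    rewiringMeasure υ (RewiringMap.cylinder V) = ENNReal.ofReal (υ.1 V : ℝ) :=
  (RewiringMap.exists_measure_cylinder υ).choose_spec.2 V

theorem eq_rewiringMeasure (υ : RewiringLimits) (μ : Measure (RewiringMap ℕ))
    [IsProbabilityMeasure μ]
    (h : ∀ V, μ (RewiringMap.cylinder V) = ENNReal.ofReal (υ.1 V : ℝ)) :
    μ = rewiringMeasure υ := by
  refine ext_of_generate_finite _ RewiringMap.generateFrom_cylinders
    RewiringMap.isPiSystem_cylinders ?_ (by simp)
  rintro s (rfl | ⟨V, rfl⟩)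
  · simp
  · rw [h, rewiringMeasure_cylinder]

theorem measurable_rewiringMeasure : Measurable rewiringMeasure := by
  refine Measurable.measure_of_isPiSystem_of_isProbabilityMeasure
    RewiringMap.generateFrom_cylinders RewiringMap.isPiSystem_cylinders ?_
  rintro s (rfl | ⟨V, rfl⟩)
  · simp
  · simp only [rewiringMeasure_cylinder]
    exact ENNReal.measurable_ofReal.comp (measurable_subtype_coe.comp
      ((measurable_pi_apply V).comp measurable_subtype_coe))

/-- The mixture `Ω_Υ(·) = ∫ Ω_υ(·) Υ(dυ)`. -/
noncomputable def rewiringMixture (Υ : Measure RewiringLimits) : Measure (RewiringMap ℕ) :=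
  Υ.bind rewiringMeasure

theorem rewiringMixture_apply (Υ : Measure RewiringLimits) {s : Set (RewiringMap ℕ)}
    (hs : MeasurableSet s) : rewiringMixture Υ s = ∫⁻ υ, rewiringMeasure υ s ∂Υ :=
  Measure.bind_apply hs measurable_rewiringMeasure.aemeasurable

/-- A random rewiring map `W` on a probability space is exchangeable if `W^σ` has the same law as
`W` for every finite permutation `σ` of the vertices. -/
def IsExchangeable {S : Type*} [MeasurableSpace S] (P : Measure S) (W : S → RewiringMap ℕ) : Prop :=
  ∀ σ : Equiv.Perm ℕ, {i | σ i ≠ i}.Finite → P.map (fun s => (W s).comap σ) = P.map W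

/-! The key is an intrinsic description of the limits: `υ` is a limit exactly when it gives the
cylinder probabilities of an exchangeable law and satisfies the quadratic identities `Dissociated`
(`dissociatedCylinders_eq`). These conditions cut out a compact set, since the laws on a compact
space form a compact space. Every limit point of the densities of any `w`, convergent or not, meets
the conditions (`mem_dissociatedCylinders_of_tendsto`): two independent samples of `m` vertices
overlap with probability O(1/n), and the laws of randomly permuted copies of `w` accumulate at an
exchangeable law. Conversely, under an exchangeable dissociated law the density of `V` has mean `υ
V` and variance O(1/n), so almost every `w` has limit `υ` (`ae_isRewiringLimit`). Hence
`rewiringMeasure υ` lives on the maps with limit `υ`, so a mixture determines its mixing measure as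
the law of the limit. For existence, take a cluster point of the laws of the densities of `W`
restricted to `[n]`. It lives on limits because the distance to them tends to zero for each `w`, and
it has the right cylinder means because expected densities do not depend on `n`. No almost sure
convergence for `W` itself is needed. -/

namespace RewiringMap

/-! ### Squares of densities and pairs of disjoint samples -/

open Classical in
/-- The rewiring maps on `2m` vertices both of whose halves are equal to `V`. -/
noncomputable def doubles {m : ℕ} (V : RewiringMap (Fin m)) :
    Finset (RewiringMap (Fin (m + m))) :=
  Finset.univ.filter fun U => comap (Fin.castAdd m) U = V ∧ comap (Fin.natAdd m) U = V

theorem ind_le_descFactorial {m n : ℕ} (V : RewiringMap (Fin m)) (W : RewiringMap (Fin n)) :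
    ind V W ≤ n.descFactorial m := by
  classical
  rw [ind, Nat.card_eq_fintype_card]
  refine (Fintype.card_subtype_le _).trans_eq ?_
  rw [Fintype.card_embedding_eq, Fintype.card_fin, Fintype.card_fin]

theorem density_nonneg {m n : ℕ} (V : RewiringMap (Fin m)) (W : RewiringMap (Fin n)) :
    0 ≤ density V W := by
  unfold density; positivity

theorem density_le_one {m n : ℕ} (V : RewiringMap (Fin m)) (W : RewiringMap (Fin n)) :
    density V W ≤ 1 :=
  div_le_one_of_le₀ (by exact_mod_cast ind_le_descFactorial V W) (by positivity)

theorem sum_ind_doubles {m n : ℕ} (V : RewiringMap (Fin m)) (W : RewiringMap (Fin n)) :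
    ∑ U ∈ doubles V, ind U W =
      Nat.card {ψ : Fin (m + m) ↪ Fin n //
        comap (fun i => ψ (Fin.castAdd m i)) W = V ∧ comap (fun i => ψ (Fin.natAdd m i)) W = V} := by
  classical
  rw [Nat.card_eq_fintype_card, Fintype.card_subtype,
    Finset.card_eq_sum_card_fiberwise (f := fun ψ : Fin (m + m) ↪ Fin n => comap ψ W)
      (t := doubles V)]
  · refine Finset.sum_congr rfl fun U hU => ?_
    rw [ind, Nat.card_eq_fintype_card, Fintype.card_subtype, Finset.filter_filter]
    congr 1
    ext ψ
    simp only [Finset.mem_filter, Finset.mem_univ, true_and, doubles] at hU ⊢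
    constructor
    · rintro rfl; exact ⟨hU, rfl⟩
    · exact fun h => h.2
  · intro ψ hψ
    simp only [Finset.coe_filter, Set.mem_ofPred_eq, Finset.mem_univ, true_and] at hψ
    exact Finset.mem_filter.2 ⟨Finset.mem_univ _, hψ⟩

/-- Conditioning a uniform choice among `N` objects on a subset of size `M` changes the probability
of an event by at most the probability of the complement. -/
theorem abs_div_sub_div_le {a b N M : ℝ} (hM : 0 < M) (hMN : M ≤ N) (hb : 0 ≤ b) (hbM : b ≤ M)
    (hba : b ≤ a) (hab : a - b ≤ N - M) : |a / N - b / M| ≤ (N - M) / N := by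
  have hN : 0 < N := hM.trans_le hMN
  rw [abs_sub_le_iff]
  constructor
  · have h : b / N ≤ b / M := div_le_div_of_nonneg_left hb hM hMN
    have : a / N - b / N ≤ (N - M) / N := by rw [← sub_div]; gcongr
    linarith
  · have h1 : b / N ≤ a / N := by gcongr
    have h2 : b / M - b / N ≤ (N - M) / N := by
      have : b / M - b / N = b / M * ((N - M) / N) := by field_simp
      rw [this]
      exact mul_le_of_le_one_left (div_nonneg (by linarith) hN.le) ((div_le_one hM).2 hbM)
    linarith

/-- The ratio is the probability that two independent samples of `m` vertices are disjoint. Each of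
its `m` factors is `1 - m/(n-k)`, at least `1 - 2m/n` because `n - k ≥ n/2`. -/
theorem descFactorial_ratio {m n : ℕ} (h : 2 * m ≤ n) (hn : 0 < n) :
    1 - 2 * (m : ℝ) ^ 2 / n ≤ ((n - m).descFactorial m : ℝ) / n.descFactorial m := by
  have hn' : (0 : ℝ) < n := by exact_mod_cast hn
  -- The number `k` of factors varies while the shift `m` stays fixed, so that the induction adds
  -- one factor at a time.
  have key : ∀ k ≤ m, (1 - 2 * (k : ℝ) * m / n) * n.descFactorial k ≤
      ((n - m).descFactorial k : ℝ) := by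
    intro k
    induction k with
    | zero => intro; simp
    | succ k ih =>
      intro hk
      have ih := ih (by omega)
      rw [Nat.descFactorial_succ, Nat.descFactorial_succ]
      push_cast [Nat.cast_sub (show k ≤ n by omega), Nat.cast_sub (show k ≤ n - m by omega),
        Nat.cast_sub (show m ≤ n by omega)]
      have hkm : (k : ℝ) + 1 ≤ m := by exact_mod_cast hk
      have hmn : 2 * (m : ℝ) ≤ n := by exact_mod_cast h
      have hD : (0 : ℝ) ≤ n.descFactorial k := by positivity
      have hk0 : (0 : ℝ) ≤ k := by positivity
      have h1 : 0 ≤ (n : ℝ) - m - k := by linarith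
      have hfac : (1 - 2 * ((k : ℝ) + 1) * m / n) * (n - k) ≤
          (n - m - k) * (1 - 2 * (k : ℝ) * m / n) := by
        have e : (n - m - k) * (1 - 2 * (k : ℝ) * m / n) -
            (1 - 2 * ((k : ℝ) + 1) * m / n) * (n - k) =
            m * (n - 2 * k + 2 * k * m) / n := by
          field_simp; ring
        have : 0 ≤ m * (n - 2 * k + 2 * (k : ℝ) * m) / n := by
          apply div_nonneg _ hn'.le
          apply mul_nonneg (by positivity)
          nlinarith
        linarith
      calc _ = ((1 - 2 * ((k : ℝ) + 1) * m / n) * (n - k)) * n.descFactorial k := by ring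
        _ ≤ ((n - m - k) * (1 - 2 * (k : ℝ) * m / n)) * n.descFactorial k := by gcongr
        _ = (n - m - k) * ((1 - 2 * (k : ℝ) * m / n) * n.descFactorial k) := by ring
        _ ≤ _ := by gcongr
  have hpos : (0 : ℝ) < n.descFactorial m := by
    exact_mod_cast Nat.descFactorial_pos.2 (by omega)
  rw [le_div_iff₀ hpos]
  refine (le_of_eq ?_).trans (key m le_rfl)
  ring

/-- The square counts pairs of injections showing `V`; the sum counts those pairs with disjoint
images, glued into one injection of `m + m` points. The two differ by at most the proportion of
overlapping pairs. -/
theorem abs_sq_density_sub_le {m n : ℕ} (V : RewiringMap (Fin m)) (W : RewiringMap (Fin n))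
    (h : 2 * m ≤ n) (hn : 0 < n) :
    |density V W ^ 2 - ∑ U ∈ doubles V, density U W| ≤ 2 * (m : ℝ) ^ 2 / n := by
  classical
  let E := Fin m ↪ Fin n
  let split : (Fin (m + m) ↪ Fin n) → E × E := fun ψ =>
    ((Fin.castAddEmb m).trans ψ, (Fin.natAddEmb m).trans ψ)
  have hinj : Function.Injective split := by
    intro ψ φ hψ
    ext i
    obtain ⟨h1, h2⟩ := Prod.ext_iff.1 hψ
    induction i using Fin.addCases with
    | left i => exact congrArg Fin.val (DFunLike.congr_fun h1 i)
    | right i => exact congrArg Fin.val (DFunLike.congr_fun h2 i)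
  let A : Finset E := Finset.univ.filter fun ψ => comap ψ W = V
  let B : Finset (Fin (m + m) ↪ Fin n) := Finset.univ.filter fun ψ =>
    comap (fun i => ψ (Fin.castAdd m i)) W = V ∧ comap (fun i => ψ (Fin.natAdd m i)) W = V
  have hA : ind V W = A.card := by
    rw [ind, Nat.card_eq_fintype_card, Fintype.card_subtype]
  have hB : ∑ U ∈ doubles V, ind U W = B.card := by
    rw [sum_ind_doubles, Nat.card_eq_fintype_card, Fintype.card_subtype]
  have hBA : B.image split ⊆ A ×ˢ A := by
    intro p hp
    obtain ⟨ψ, hψ, rfl⟩ := Finset.mem_image.1 hp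
    simp only [B, Finset.mem_filter, Finset.mem_univ, true_and] at hψ
    exact Finset.mk_mem_product (Finset.mem_filter.2 ⟨Finset.mem_univ _, hψ.1⟩)
      (Finset.mem_filter.2 ⟨Finset.mem_univ _, hψ.2⟩)
  -- A pair showing `V` twice but missed by `B` must overlap. This bounds `|A|² - |B|` by the number
  -- of overlapping pairs.
  have hcompl : (A ×ˢ A) \ B.image split ⊆ Finset.univ \ Finset.univ.image split := by
    intro p hp
    simp only [Finset.mem_sdiff, Finset.mem_univ, true_and, Finset.mem_image, not_exists] at hp ⊢
    rintro ψ rfl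
    obtain ⟨h1, h2⟩ := Finset.mem_product.1 hp.1
    exact hp.2 ψ ⟨Finset.mem_filter.2 ⟨Finset.mem_univ _, (Finset.mem_filter.1 h1).2,
      (Finset.mem_filter.1 h2).2⟩, rfl⟩
  have hc1 := Finset.card_le_card hBA
  have hc2 := Finset.card_le_card hcompl
  have hc3 : B.card ≤ n.descFactorial (m + m) := by
    refine (Finset.card_le_univ B).trans_eq ?_
    rw [Fintype.card_embedding_eq, Fintype.card_fin, Fintype.card_fin]
  have hc4 : (Finset.univ.image split).card = n.descFactorial (m + m) := by
    rw [Finset.card_image_of_injective _ hinj, Finset.card_univ, Fintype.card_embedding_eq,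
      Fintype.card_fin, Fintype.card_fin]
  have hc5 : (Finset.univ : Finset (E × E)).card = n.descFactorial m * n.descFactorial m := by
    rw [Finset.card_univ, Fintype.card_prod, Fintype.card_embedding_eq, Fintype.card_fin,
      Fintype.card_fin]
  have hc6 := Finset.card_le_card (Finset.subset_univ (Finset.univ.image split))
  rw [Finset.card_sdiff_of_subset hBA, Finset.card_sdiff_of_subset (Finset.subset_univ _),
    hc4, hc5, Finset.card_image_of_injective _ hinj, Finset.card_product] at hc2
  rw [hc4, hc5] at hc6
  rw [Finset.card_image_of_injective _ hinj, Finset.card_product] at hc1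
  have hN : (0 : ℝ) < n.descFactorial m := by
    exact_mod_cast Nat.descFactorial_pos.2 (by omega)
  have hM : (0 : ℝ) < n.descFactorial (m + m) := by
    exact_mod_cast Nat.descFactorial_pos.2 (by omega)
  have hsum : ∑ U ∈ doubles V, density U W = (B.card : ℝ) / n.descFactorial (m + m) := by
    simp only [density]
    rw [← Finset.sum_div, ← hB]
    push_cast; rfl
  have hsq : density V W ^ 2 =
      ((A.card * A.card : ℕ) : ℝ) / ((n.descFactorial m * n.descFactorial m : ℕ) : ℝ) := by
    rw [density, hA]; push_cast; rw [div_pow, sq, sq]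
  have hsplit : (n.descFactorial (m + m) : ℝ) = n.descFactorial m * (n - m).descFactorial m := by
    have := Nat.descFactorial_mul_descFactorial (n := n) (show m ≤ m + m by omega)
    rw [Nat.add_sub_cancel] at this
    rw [← this]; push_cast; ring
  rw [hsq, hsum]
  refine (abs_div_sub_div_le hM (by exact_mod_cast hc6) (by positivity) (by exact_mod_cast hc3)
    (by exact_mod_cast hc1) ?_).trans ?_
  · have : ((A.card * A.card - B.card : ℕ) : ℝ) ≤
        ((n.descFactorial m * n.descFactorial m - n.descFactorial (m + m) : ℕ) : ℝ) := by
      exact_mod_cast hc2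
    rwa [Nat.cast_sub hc1, Nat.cast_sub hc6] at this
  · have hr := descFactorial_ratio h hn
    have : (((n.descFactorial m * n.descFactorial m : ℕ) : ℝ) - n.descFactorial (m + m)) /
        ((n.descFactorial m * n.descFactorial m : ℕ) : ℝ) =
        1 - ((n - m).descFactorial m : ℝ) / n.descFactorial m := by
      rw [hsplit]; push_cast; field_simp
    rw [this]; linarith

/-! ### Convergence along squares implies convergence -/

theorem ind_restrict_mono {m : ℕ} (V : RewiringMap (Fin m)) (w : RewiringMap ℕ) :
    Monotone fun n => ind V (w.restrict n) := by
  intro n k h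
  classical
  refine Nat.card_le_card_of_injective
    (fun ψ : {ψ : Fin m ↪ Fin n // comap ψ (w.restrict n) = V} =>
      (⟨ψ.1.trans (Fin.castLEEmb h), ψ.2⟩ :
        {ψ : Fin m ↪ Fin k // comap ψ (w.restrict k) = V})) ?_
  intro ψ φ hψ
  ext i
  have := congrArg Fin.val (DFunLike.congr_fun (congrArg Subtype.val hψ) i)
  exact this

theorem tendsto_sqrt_atTop : Tendsto Nat.sqrt atTop atTop :=
  tendsto_atTop_mono' _ (Eventually.of_forall fun _ => le_rfl) <|
    tendsto_atTop_atTop.2 fun b => ⟨b * b, fun _ ha => Nat.le_sqrt.2 ha⟩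

theorem tendsto_descFactorial_sq_ratio (m : ℕ) :
    Tendsto (fun k : ℕ => (((k + 1) ^ 2).descFactorial m : ℝ) / ((k ^ 2).descFactorial m : ℝ))
      atTop (𝓝 1) := by
  have hsq : Tendsto (fun k : ℕ => k ^ 2) atTop atTop := tendsto_pow_atTop two_ne_zero
  have h := isEquivalent_descFactorial m
  have h1 := h.comp_tendsto (hsq.comp (tendsto_add_atTop_nat 1))
  have h2 := h.comp_tendsto hsq
  have h3 := (h1.div h2).tendsto_nhds_iff (c := 1)
  refine h3.2 ?_
  have h4 : Tendsto (fun k : ℕ => ((1 + 1 / (k : ℝ)) ^ 2) ^ m) atTop (𝓝 (((1 + 0) ^ 2) ^ m)) :=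
    ((tendsto_const_nhds.add tendsto_one_div_atTop_nhds_zero_nat).pow 2).pow m
  simp only [add_zero, one_pow] at h4
  refine h4.congr' ?_
  filter_upwards [eventually_gt_atTop 0] with k hk
  have hk' : (k : ℝ) ≠ 0 := by exact_mod_cast hk.ne'
  simp only [Function.comp, Pi.div_apply]
  push_cast
  rw [← div_pow, ← div_pow]
  congr 2
  field_simp

/-- Both `ind` and the falling factorial increase with `n`, so the density at `n` lies between mixed
quotients from the two neighbouring squares, whose falling factorials have ratio tending to 1. -/
theorem tendsto_density_of_tendsto_sq {m : ℕ} (V : RewiringMap (Fin m)) (w : RewiringMap ℕ)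
    {l : ℝ} (h : Tendsto (fun k : ℕ => density V (w.restrict (k ^ 2))) atTop (𝓝 l)) :
    Tendsto (fun n => density V (w.restrict n)) atTop (𝓝 l) := by
  have hr := tendsto_descFactorial_sq_ratio m
  have h1 := h.comp (tendsto_add_atTop_nat 1)
  have hup := ((h1.mul hr).comp tendsto_sqrt_atTop)
  have hlow := ((h.div hr one_ne_zero).comp tendsto_sqrt_atTop)
  rw [mul_one] at hup
  rw [div_one] at hlow
  have hpos : ∀ᶠ n : ℕ in atTop, m ≤ n.sqrt ^ 2 := by
    filter_upwards [tendsto_sqrt_atTop.eventually_ge_atTop m] with n hn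
    nlinarith
  refine tendsto_of_tendsto_of_tendsto_of_le_of_le' hlow hup ?_ ?_
  all_goals
    filter_upwards [hpos] with n hn
    have e1 : n.sqrt ^ 2 ≤ n := Nat.sqrt_le' n
    have e2 : n ≤ (n.sqrt + 1) ^ 2 := (Nat.lt_succ_sqrt' n).le
    have p1 : (0 : ℝ) < (n.sqrt ^ 2).descFactorial m := by
      exact_mod_cast Nat.descFactorial_pos.2 hn
    have p2 : (0 : ℝ) < n.descFactorial m := by
      exact_mod_cast Nat.descFactorial_pos.2 (hn.trans e1)
    have p3 : (0 : ℝ) < ((n.sqrt + 1) ^ 2).descFactorial m := by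
      exact_mod_cast Nat.descFactorial_pos.2 (hn.trans (e1.trans e2))
    simp only [Function.comp, density]
  · have : (ind V (w.restrict (n.sqrt ^ 2)) : ℝ) / (n.sqrt ^ 2).descFactorial m /
        (((n.sqrt + 1) ^ 2).descFactorial m / (n.sqrt ^ 2).descFactorial m) =
        ind V (w.restrict (n.sqrt ^ 2)) / ((n.sqrt + 1) ^ 2).descFactorial m := by
      field_simp
    simp only [Pi.div_apply, this]
    exact div_le_div₀ (by positivity) (by exact_mod_cast ind_restrict_mono V w e1) p2
      (by exact_mod_cast Nat.descFactorial_le _ e2)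
  · have : (ind V (w.restrict ((n.sqrt + 1) ^ 2)) : ℝ) / ((n.sqrt + 1) ^ 2).descFactorial m *
        (((n.sqrt + 1) ^ 2).descFactorial m / (n.sqrt ^ 2).descFactorial m) =
        ind V (w.restrict ((n.sqrt + 1) ^ 2)) / (n.sqrt ^ 2).descFactorial m := by
      field_simp
    rw [this]
    exact div_le_div₀ (by positivity) (by exact_mod_cast ind_restrict_mono V w e2) p1
      (by exact_mod_cast Nat.descFactorial_le _ e1)

/-! ### Moments of densities under exchangeable laws -/

/-- Joint exchangeability of a law, expressed through injective samples of vertices. -/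
def ExchangeableLaw (μ : Measure (RewiringMap ℕ)) : Prop :=
  ∀ (V : FiniteRewiringMap) (ψ : Fin V.1 ↪ ℕ), μ {w | comap ψ w = V.2} = μ (cylinder V)

theorem continuous_comap {ι κ : Type} (f : κ → ι) : Continuous (comap f) := by
  refine Continuous.subtype_mk (continuous_pi fun i => continuous_pi fun j => ?_) _
  exact (continuous_apply_apply (f i) (f j)).comp continuous_subtype_val

theorem isClopen_comap {m : ℕ} (V : RewiringMap (Fin m)) (f : Fin m → ℕ) :
    IsClopen {w : RewiringMap ℕ | comap f w = V} :=
  (isClopen_discrete {V}).preimage (continuous_comap f)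

theorem continuous_density_restrict {m : ℕ} (V : RewiringMap (Fin m)) (n : ℕ) :
    Continuous fun w : RewiringMap ℕ => density V (w.restrict n) :=
  (continuous_of_discreteTopology (f := fun W : RewiringMap (Fin n) => density V W)).comp
    (continuous_restrict n)

theorem integrable_of_continuous (μ : Measure (RewiringMap ℕ)) [IsFiniteMeasure μ]
    {f : RewiringMap ℕ → ℝ} (hf : Continuous f) : Integrable f μ :=
  hf.integrable_of_hasCompactSupport (HasCompactSupport.of_compactSpace f)

theorem ind_eq_sum_indicator {m n : ℕ} (V : RewiringMap (Fin m)) (w : RewiringMap ℕ) :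
    (ind V (w.restrict n) : ℝ) = ∑ ψ : Fin m ↪ Fin n,
      Set.indicator {w : RewiringMap ℕ | comap (fun i => (ψ i : ℕ)) w = V} (fun _ => (1 : ℝ)) w := by
  classical
  simp only [Set.indicator_apply, Finset.sum_boole]
  rw [ind, Nat.card_eq_fintype_card, Fintype.card_subtype]
  rfl

/-- The density averages, over all injections, indicators of events that exchangeability makes
equally likely. -/
theorem ExchangeableLaw.integral_density {μ : Measure (RewiringMap ℕ)} [IsFiniteMeasure μ]
    (hμ : ExchangeableLaw μ) (V : FiniteRewiringMap) {n : ℕ} (hn : (V.1 : ℕ) ≤ n) :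
    ∫ w, density V.2 (w.restrict n) ∂μ = μ.real (cylinder V) := by
  have hpos : (0 : ℝ) < n.descFactorial V.1 := by
    exact_mod_cast Nat.descFactorial_pos.2 hn
  simp only [density, integral_div, ind_eq_sum_indicator]
  rw [integral_finsetSum]
  · have : ∀ ψ : Fin V.1 ↪ Fin n, ∫ w, Set.indicator
        {w : RewiringMap ℕ | comap (fun i => (ψ i : ℕ)) w = V.2} (fun _ => (1 : ℝ)) w ∂μ =
        μ.real (cylinder V) := by
      intro ψ
      rw [integral_indicator_const _ (isClopen_comap V.2 _).isOpen.measurableSet, smul_eq_mul,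
        mul_one, Measure.real, Measure.real]
      exact congrArg _ (hμ V (ψ.trans Fin.valEmbedding))
    simp only [this, Finset.sum_const, Finset.card_univ, Fintype.card_embedding_eq,
      Fintype.card_fin, nsmul_eq_mul]
    field_simp
  · intro ψ _
    exact (integrable_const (1 : ℝ)).indicator (isClopen_comap V.2 _).isOpen.measurableSet

/-- The densities of `w|_[n]`, as a point of the cube. -/
noncomputable def densities (n : ℕ) (w : RewiringMap ℕ) (V : FiniteRewiringMap) :
    Set.Icc (0 : ℝ) 1 :=
  ⟨density V.2 (w.restrict n), density_nonneg _ _, density_le_one _ _⟩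

theorem continuous_densities (n : ℕ) : Continuous (densities n) :=
  continuous_pi fun V => (continuous_density_restrict V.2 n).subtype_mk _

theorem isRewiringLimit_iff {w : RewiringMap ℕ} {υ : FiniteRewiringMap → Set.Icc (0 : ℝ) 1} :
    IsRewiringLimit w υ ↔ Tendsto (fun n => densities n w) atTop (𝓝 υ) := by
  rw [tendsto_pi_nhds]
  exact forall_congr' fun V => (tendsto_subtype_rng (f := fun n => densities n w V)).symm

/-- The quadratic identities expressing that disjoint samples of vertices are independent. -/
def Dissociated (υ : FiniteRewiringMap → Set.Icc (0 : ℝ) 1) : Prop :=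
  ∀ V : FiniteRewiringMap,
    (υ V : ℝ) ^ 2 = ∑ U ∈ doubles V.2, (υ ⟨V.1 + V.1, U⟩ : ℝ)

/-- The cylinder probabilities of exchangeable dissociated laws. -/
def dissociatedCylinders : Set (FiniteRewiringMap → Set.Icc (0 : ℝ) 1) :=
  {υ | Dissociated υ ∧ ∃ μ : ProbabilityMeasure (RewiringMap ℕ),
    ExchangeableLaw μ ∧ ∀ V, (μ : Measure (RewiringMap ℕ)).real (cylinder V) = υ V}

/-- A variance bound: expand the square and replace the squared density by the sum over `doubles`,
at the cost of the overlap error. Dissociation makes the mean of that sum `(υ V)²`, so everything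
but the error cancels. -/
theorem lintegral_sq_density_sub_le {μ : Measure (RewiringMap ℕ)} [IsProbabilityMeasure μ]
    (hμ : ExchangeableLaw μ) {υ : FiniteRewiringMap → Set.Icc (0 : ℝ) 1} (hυ : Dissociated υ)
    (h : ∀ V, μ.real (cylinder V) = υ V) (V : FiniteRewiringMap) {n : ℕ} (hn : 2 * (V.1 : ℕ) ≤ n) :
    ∫⁻ w, ENNReal.ofReal ((density V.2 (w.restrict n) - υ V) ^ 2) ∂μ ≤
      ENNReal.ofReal (2 * (V.1 : ℝ) ^ 2 / n) := by
  have hV : 0 < (V.1 : ℕ) := V.1.pos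
  have hc := continuous_density_restrict V.2 n
  rw [← ofReal_integral_eq_lintegral_ofReal
    (f := fun w => (density V.2 (w.restrict n) - (υ V : ℝ)) ^ 2)
    (integrable_of_continuous μ (by fun_prop))
    (Eventually.of_forall fun w => sq_nonneg _)]
  refine ENNReal.ofReal_le_ofReal ?_
  have hS : Continuous fun w : RewiringMap ℕ => ∑ U ∈ doubles V.2, density U (w.restrict n) :=
    continuous_finsetSum _ fun U _ => continuous_density_restrict U n
  have hint : ∫ w, ((∑ U ∈ doubles V.2, density U (w.restrict n)) -
      2 * (υ V : ℝ) * density V.2 (w.restrict n) + (υ V : ℝ) ^ 2 + 2 * (V.1 : ℝ) ^ 2 / n) ∂μ =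
      2 * (V.1 : ℝ) ^ 2 / n := by
    rw [integral_add (integrable_of_continuous μ (by fun_prop)) (integrable_const _),
      integral_add (integrable_of_continuous μ (by fun_prop)) (integrable_const _),
      integral_sub (integrable_of_continuous μ (by fun_prop))
        (integrable_of_continuous μ (by fun_prop)),
      integral_const_mul, hμ.integral_density V (by omega), h V,
      integral_finsetSum _ fun U _ => integrable_of_continuous μ (continuous_density_restrict U n)]
    have : ∀ U ∈ doubles V.2, ∫ w, density U (w.restrict n) ∂μ = υ ⟨V.1 + V.1, U⟩ := by
      intro U _
      rw [← h]
      refine hμ.integral_density ⟨V.1 + V.1, U⟩ ?_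
      rw [PNat.add_coe]; omega
    rw [Finset.sum_congr rfl this, ← hυ V]
    simp
    ring
  rw [← hint]
  refine integral_mono (integrable_of_continuous μ (by fun_prop))
    (integrable_of_continuous μ (by fun_prop)) fun w => ?_
  have := (abs_sub_le_iff.1 (abs_sq_density_sub_le V.2 (w.restrict n) hn (by omega))).1
  simp only
  linarith

/-- The O(1/n) variance is not summable over all `n` but is over squares. There the squared
deviations have finite expected sum, hence tend to zero almost surely; monotonicity fills the gaps
between squares. -/
theorem ae_isRewiringLimit {μ : Measure (RewiringMap ℕ)} [IsProbabilityMeasure μ]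
    (hμ : ExchangeableLaw μ) {υ : FiniteRewiringMap → Set.Icc (0 : ℝ) 1} (hυ : Dissociated υ)
    (h : ∀ V, μ.real (cylinder V) = υ V) : ∀ᵐ w ∂μ, IsRewiringLimit w υ := by
  refine ae_all_iff.2 fun V => ?_
  -- Shifting by `K` makes every sample size `(k + K) ^ 2` at least `2m`, as the variance bound
  -- requires.
  let K : ℕ := 2 * V.1
  have hmeas : ∀ k : ℕ, Measurable fun w : RewiringMap ℕ =>
      ENNReal.ofReal ((density V.2 (w.restrict ((k + K) ^ 2)) - υ V) ^ 2) := fun k =>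
    ENNReal.measurable_ofReal.comp
      (((continuous_density_restrict V.2 _).sub continuous_const).pow 2).measurable
  have hsum : Summable fun k : ℕ => 2 * (V.1 : ℝ) ^ 2 / (((k + K) ^ 2 : ℕ) : ℝ) := by
    have := (Real.summable_nat_pow_inv.2 one_lt_two).mul_left (2 * (V.1 : ℝ) ^ 2)
    have := (summable_nat_add_iff K).2 this
    refine this.congr fun k => ?_
    push_cast; rfl
  have hfin : ∫⁻ w, ∑' k : ℕ,
      ENNReal.ofReal ((density V.2 (w.restrict ((k + K) ^ 2)) - υ V) ^ 2) ∂μ ≠ ⊤ := by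
    rw [lintegral_tsum fun k => (hmeas k).aemeasurable]
    refine ne_top_of_le_ne_top hsum.tsum_ofReal_ne_top (ENNReal.tsum_le_tsum fun k => ?_)
    refine lintegral_sq_density_sub_le hμ hυ h V ?_
    change K ≤ (k + K) ^ 2
    nlinarith [Nat.zero_le k, Nat.zero_le K, sq_nonneg (k : ℤ)]
  filter_upwards [ae_lt_top (Measurable.tsum hmeas) hfin] with w hw
  refine tendsto_density_of_tendsto_sq V.2 w ?_
  rw [← tendsto_add_atTop_iff_nat K]
  have h0 := ENNReal.tendsto_atTop_zero_of_tsum_ne_top hw.ne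
  have h1 := (ENNReal.tendsto_toReal ENNReal.zero_ne_top).comp h0
  simp only [ENNReal.toReal_zero] at h1
  have h2 : Tendsto (fun k : ℕ => (density V.2 (w.restrict ((k + K) ^ 2)) - υ V) ^ 2) atTop
      (𝓝 0) := by
    refine h1.congr fun k => ?_
    simp [Function.comp, ENNReal.toReal_ofReal (sq_nonneg _)]
  have h3 := (Real.continuous_sqrt.tendsto 0).comp h2
  simp only [Real.sqrt_zero] at h3
  rw [tendsto_iff_dist_tendsto_zero]
  refine h3.congr fun k => ?_
  simp [Function.comp, Real.sqrt_sq_eq_abs, Real.dist_eq]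

/-! ### Exchangeability and random permutations -/

theorem exists_perm_extending {m N : ℕ} (ψ : Fin m ↪ ℕ) (h : m ≤ N) (hψ : ∀ i, ψ i < N) :
    ∃ τ : Equiv.Perm (Fin N), ∀ i : Fin m, ((τ (Fin.castLE h i) : Fin N) : ℕ) = ψ i := by
  obtain ⟨τ, hτ⟩ := Equiv.Perm.exists_extending_pair (Fin.castLEEmb h)
    (fun i => (⟨ψ i, hψ i⟩ : Fin N)) (Fin.castLEEmb h).injective
    fun i j hij => ψ.injective (congrArg Fin.val hij)
  exact ⟨τ, fun i => congrArg Fin.val (hτ i)⟩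

theorem exists_forall_lt {m : ℕ} (ψ : Fin m → ℕ) : ∃ N, m ≤ N ∧ ∀ i, ψ i < N :=
  ⟨m + ∑ i, ψ i + 1, by omega, fun i => by
    have := Finset.single_le_sum (f := ψ) (fun _ _ => Nat.zero_le _) (Finset.mem_univ i)
    omega⟩

/-- Any injection of finitely many vertices into `ℕ` extends to a permutation moving only finitely
many points. -/
theorem _root_.IsExchangeable.exchangeableLaw {S : Type*} [MeasurableSpace S] {P : Measure S}
    {W : S → RewiringMap ℕ} (hW : Measurable W) (h : IsExchangeable P W) :
    ExchangeableLaw (P.map W) := by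
  intro V ψ
  obtain ⟨N, hN, hψ⟩ := exists_forall_lt ψ
  obtain ⟨τ, hτ⟩ := exists_perm_extending ψ hN hψ
  let σ : Equiv.Perm ℕ := τ.extendDomain Fin.equivSubtype
  have hσ : ∀ i : Fin V.1, σ i = ψ i := by
    intro i
    rw [← hτ i]
    exact τ.extendDomain_apply_image Fin.equivSubtype (Fin.castLE hN i)
  have hfin : {i | σ i ≠ i}.Finite := by
    refine (Set.finite_lt_nat N).subset fun i hi => ?_
    by_contra hiN
    exact hi (τ.extendDomain_apply_not_subtype Fin.equivSubtype hiN)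
  calc P.map W {w | comap ψ w = V.2} = P {s | comap ψ (W s) = V.2} :=
        Measure.map_apply hW (isClopen_comap V.2 ψ).isOpen.measurableSet
    _ = P {s | (W s).comap σ ∈ cylinder V} := ?_
    _ = P.map (fun s => (W s).comap σ) (cylinder V) :=
        (Measure.map_apply ((continuous_comap σ).measurable.comp hW)
          (measurableSet_cylinder V)).symm
    _ = P.map W (cylinder V) := by rw [h σ hfin]
  congr 1
  ext s
  have : restrict V.1 ((W s).comap σ) = comap ψ (W s) := by
    ext i j <;> simp [restrict, comap, hσ]
  simp only [Set.mem_ofPred_eq, cylinder, this]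

/-- The law of `w` with its first `n` vertices permuted uniformly at random. -/
noncomputable def permutedLaw (w : RewiringMap ℕ) (n : ℕ) : ProbabilityMeasure (RewiringMap ℕ) :=
  ⟨((PMF.uniformOfFintype (Equiv.Perm (Fin n))).map fun σ => comap (extendPerm σ) w).toMeasure,
    inferInstance⟩

/-- Right translation by a permutation extending `ψ` preserves the uniform law. The value is thus
the same for every `ψ` into `[n]`, which makes limits of these laws exchangeable as `n` grows. -/
theorem permutedLaw_apply (w : RewiringMap ℕ) {m n : ℕ} (V : RewiringMap (Fin m)) (ψ : Fin m ↪ ℕ)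
    (h : m ≤ n) (hψ : ∀ i, ψ i < n) :
    (permutedLaw w n : Measure (RewiringMap ℕ)).real {u | comap ψ u = V} =
      density V (w.restrict n) := by
  classical
  obtain ⟨τ, hτ⟩ := exists_perm_extending ψ h hψ
  have hset : ∀ σ : Equiv.Perm (Fin n), comap ψ (comap (extendPerm σ) w) = V ↔
      comap ((Fin.castLEEmb h).trans (σ * τ : Equiv.Perm (Fin n)).toEmbedding) (w.restrict n) =
        V := by
    intro σ
    have he : ∀ i, extendPerm σ (ψ i) = (σ (τ (Fin.castLE h i)) : ℕ) := by
      intro i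
      simp [extendPerm, ← hτ i]
    have : comap ψ (comap (extendPerm σ) w) =
        comap ((Fin.castLEEmb h).trans (σ * τ : Equiv.Perm (Fin n)).toEmbedding)
          (w.restrict n) := by
      ext i j <;> simp [restrict, comap, he]
    rw [this]
  have hcard : Nat.card {σ : Equiv.Perm (Fin n) // comap ψ (comap (extendPerm σ) w) = V} =
      Nat.card {σ : Equiv.Perm (Fin n) //
        comap ((Fin.castLEEmb h).trans σ.toEmbedding) (w.restrict n) = V} :=
    Nat.card_congr ((Equiv.mulRight τ).subtypeEquiv hset)
  have hc := card_perm_eq h fun ψ => comap ψ (w.restrict n) = V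
  have hm : (permutedLaw w n : Measure (RewiringMap ℕ)) {u | comap ψ u = V} =
      ((Nat.card {σ : Equiv.Perm (Fin n) // comap ψ (comap (extendPerm σ) w) = V} : ℕ) : ENNReal) /
        (n.factorial : ℕ) := by
    let _ : MeasurableSpace (Equiv.Perm (Fin n)) := ⊤
    change (PMF.map _ (PMF.uniformOfFintype _)).toMeasure _ = _
    rw [PMF.toMeasure_map_apply _ _ _ measurable_from_top
        (isClopen_comap V ψ).isOpen.measurableSet,
      PMF.toMeasure_uniformOfFintype_apply _ (by trivial), Nat.card_eq_fintype_card,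
      Fintype.card_perm, Fintype.card_fin]
    congr 2
    exact Fintype.card_congr (Equiv.refl _)
  rw [Measure.real, hm, hcard, ENNReal.toReal_div, ENNReal.toReal_natCast, ENNReal.toReal_natCast,
    density, ind, div_eq_div_iff]
  · rw [mul_comm (Nat.card {ψ : Fin m ↪ Fin n // _} : ℝ)]; exact_mod_cast hc
  · exact_mod_cast n.factorial_ne_zero
  · exact_mod_cast (Nat.descFactorial_pos.2 h).ne'

/-! ### Compactness and the description of the limits -/

theorem continuous_measureReal {s : Set (RewiringMap ℕ)} (hs : IsClopen s) :
    Continuous fun μ : ProbabilityMeasure (RewiringMap ℕ) =>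
      (μ : Measure (RewiringMap ℕ)).real s := by
  let _ := TopologicalSpace.metrizableSpaceMetric (RewiringMap ℕ)
  refine continuous_iff_continuousAt.2 fun μ => ?_
  exact (NNReal.continuous_coe.tendsto _).comp
    (ProbabilityMeasure.tendsto_measure_of_isClopen_of_tendsto tendsto_id hs)

theorem isClosed_dissociated : IsClosed {υ | Dissociated υ} := by
  simp only [Dissociated, Set.ofPred_forall]
  refine isClosed_iInter fun V => isClosed_eq ?_ ?_
  · exact (continuous_subtype_val.comp (continuous_apply V)).pow 2
  · exact continuous_finsetSum _ fun U _ => continuous_subtype_val.comp (continuous_apply _)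

theorem isClosed_exchangeableLaw :
    IsClosed {μ : ProbabilityMeasure (RewiringMap ℕ) | ExchangeableLaw μ} := by
  have : {μ : ProbabilityMeasure (RewiringMap ℕ) | ExchangeableLaw μ} =
      ⋂ (V : FiniteRewiringMap) (ψ : Fin V.1 ↪ ℕ),
        {μ : ProbabilityMeasure (RewiringMap ℕ) | (μ : Measure (RewiringMap ℕ)).real {w | comap ψ w = V.2} =
          (μ : Measure (RewiringMap ℕ)).real (cylinder V)} := by
    ext μ
    simp only [ExchangeableLaw, Set.mem_iInter, Set.mem_ofPred_eq]
    refine forall_congr' fun V => forall_congr' fun ψ => ?_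
    exact Iff.symm measureReal_eq_measureReal_iff
  rw [this]
  exact isClosed_iInter fun V => isClosed_iInter fun ψ => isClosed_eq
    (continuous_measureReal (isClopen_comap V.2 ψ)) (continuous_measureReal (isClopen_cylinder V))

theorem compactSpace_probabilityMeasure : CompactSpace (ProbabilityMeasure (RewiringMap ℕ)) := by
  let _ := TopologicalSpace.metrizableSpaceMetric (RewiringMap ℕ)
  infer_instance

/-- The cylinder probabilities of a law. -/
noncomputable def cylinderProbabilities (μ : ProbabilityMeasure (RewiringMap ℕ))
    (V : FiniteRewiringMap) : Set.Icc (0 : ℝ) 1 :=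
  ⟨(μ : Measure (RewiringMap ℕ)).real (cylinder V), measureReal_nonneg, measureReal_le_one⟩

/-- A closed condition on `υ` intersected with the continuous image of the compact set of
exchangeable laws. -/
theorem isCompact_dissociatedCylinders : IsCompact dissociatedCylinders := by
  have := compactSpace_probabilityMeasure
  have hc : Continuous cylinderProbabilities :=
    continuous_pi fun V => (continuous_measureReal (isClopen_cylinder V)).subtype_mk _
  have : dissociatedCylinders = {υ | Dissociated υ} ∩
      cylinderProbabilities '' {μ | ExchangeableLaw μ} := by
    ext υ
    refine and_congr_right fun _ => exists_congr fun μ => and_congr_right fun _ => ?_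
    rw [funext_iff]
    exact forall_congr' fun V =>
      (Subtype.ext_iff (a1 := cylinderProbabilities μ V) (a2 := υ V)).symm
  rw [this]
  exact (isClosed_exchangeableLaw.isCompact.image hc).inter_left isClosed_dissociated

/-- Convergence is assumed only along an ultrafilter, so this covers limit points for `w` without a
limit. The overlap error vanishes, giving dissociation, and the limit of the permuted laws along the
same ultrafilter supplies the exchangeable law. -/
theorem mem_dissociatedCylinders_of_tendsto {w : RewiringMap ℕ} {F : Ultrafilter ℕ}
    (hF : (F : Filter ℕ) ≤ atTop) {υ : FiniteRewiringMap → Set.Icc (0 : ℝ) 1}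
    (h : Tendsto (fun n => densities n w) F (𝓝 υ)) : υ ∈ dissociatedCylinders := by
  have hV : ∀ V : FiniteRewiringMap,
      Tendsto (fun n => density V.2 (w.restrict n)) F (𝓝 (υ V : ℝ)) := fun V =>
    tendsto_subtype_rng.1 (tendsto_pi_nhds.1 h V)
  constructor
  · intro V
    have h1 : Tendsto (fun n => |density V.2 (w.restrict n) ^ 2 -
        ∑ U ∈ doubles V.2, density U (w.restrict n)|) F
        (𝓝 |(υ V : ℝ) ^ 2 - ∑ U ∈ doubles V.2, (υ ⟨V.1 + V.1, U⟩ : ℝ)|) :=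
      (((hV V).pow 2).sub (tendsto_finsetSum _ fun U _ => hV ⟨V.1 + V.1, U⟩)).abs
    have h2 : Tendsto (fun n : ℕ => 2 * (V.1 : ℝ) ^ 2 / n) F (𝓝 0) :=
      (tendsto_const_div_atTop_nhds_zero_nat _).mono_left hF
    have h3 := le_of_tendsto_of_tendsto h1 h2 (hF (by
      filter_upwards [eventually_ge_atTop (2 * (V.1 : ℕ)), eventually_gt_atTop 0] with n hn hn0
      exact abs_sq_density_sub_le V.2 (w.restrict n) hn hn0))
    exact sub_eq_zero.1 (abs_nonpos_iff.1 h3)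
  · have := compactSpace_probabilityMeasure
    obtain ⟨μ, -, hμ⟩ := isCompact_univ.ultrafilter_le_nhds (F.map (permutedLaw w)) (by simp)
    have hμ : Tendsto (permutedLaw w) F (𝓝 μ) := hμ
    have key : ∀ (V : FiniteRewiringMap) (ψ : Fin V.1 ↪ ℕ),
        (μ : Measure (RewiringMap ℕ)).real {w | comap ψ w = V.2} = υ V := by
      intro V ψ
      have h1 := ((continuous_measureReal (isClopen_comap V.2 ψ)).tendsto μ).comp hμ
      refine tendsto_nhds_unique h1 ((hV V).congr' (hF ?_))
      obtain ⟨N, hN, hψ⟩ := exists_forall_lt ψ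
      filter_upwards [eventually_ge_atTop N] with n hn
      exact (permutedLaw_apply w V.2 ψ (hN.trans hn) fun i => (hψ i).trans_le hn).symm
    refine ⟨μ, fun V ψ => ?_, fun V => key V Fin.valEmbedding⟩
    exact Iff.mp measureReal_eq_measureReal_iff ((key V ψ).trans (key V Fin.valEmbedding).symm)

theorem dissociatedCylinders_eq :
    dissociatedCylinders = {υ | ∃ w : RewiringMap ℕ, IsRewiringLimit w υ} := by
  ext υ
  constructor
  · rintro ⟨hυ, μ, hμ, h⟩
    exact (ae_isRewiringLimit hμ hυ h).exists
  · rintro ⟨w, hw⟩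
    exact mem_dissociatedCylinders_of_tendsto (Ultrafilter.of_le atTop)
      ((isRewiringLimit_iff.1 hw).mono_left (Ultrafilter.of_le _))

theorem isCompact_setOf_isRewiringLimit :
    IsCompact {υ | ∃ w : RewiringMap ℕ, IsRewiringLimit w υ} :=
  dissociatedCylinders_eq ▸ isCompact_dissociatedCylinders

/-- The exchangeable law provided by the description of limits has the same cylinder probabilities
as `rewiringMeasure υ`, so the two coincide. -/
theorem ae_rewiringMeasure_isRewiringLimit (υ : RewiringLimits) :
    ∀ᵐ w ∂rewiringMeasure υ, IsRewiringLimit w υ.1 := by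
  have hυ : υ.1 ∈ dissociatedCylinders := by
    rw [dissociatedCylinders_eq]; exact υ.2
  obtain ⟨hd, μ, hμ, h⟩ := hυ
  have : (μ : Measure (RewiringMap ℕ)) = rewiringMeasure υ :=
    eq_rewiringMeasure υ μ fun V => by rw [← h V, ofReal_measureReal]
  rw [← this]
  exact ae_isRewiringLimit hμ hd h

theorem measurableSet_setOf_isRewiringLimit :
    MeasurableSet {υ | ∃ w : RewiringMap ℕ, IsRewiringLimit w υ} :=
  isCompact_setOf_isRewiringLimit.isClosed.measurableSet

/-! ### Uniqueness of the mixing measure -/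

theorem exists_measurable_limit : ∃ T : RewiringMap ℕ → FiniteRewiringMap → Set.Icc (0 : ℝ) 1,
    Measurable T ∧ ∀ w υ, IsRewiringLimit w υ → T w = υ := by
  -- The upper limit is measurable and defined for every `w`; its value where the densities diverge
  -- is irrelevant.
  refine ⟨fun w V => Set.projIcc 0 1 zero_le_one
    (limsup (fun n => density V.2 (w.restrict n)) atTop), ?_, ?_⟩
  · refine measurable_pi_lambda _ fun V => continuous_projIcc.measurable.comp ?_
    exact Measurable.limsup fun n => (continuous_density_restrict V.2 n).measurable
  · intro w υ h
    ext V : 1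
    simp only
    rw [(h V).limsup_eq, Set.projIcc_val]

/-- Since `T` equals `υ` almost everywhere under `rewiringMeasure υ`, the event `T ∈ A` has
probability 1 or 0 according to whether `υ ∈ A`. The mixture therefore gives it mass `Υ A`. -/
theorem rewiringMixture_injective {Υ Υ' : Measure RewiringLimits}
    (h : rewiringMixture Υ = rewiringMixture Υ') : Υ = Υ' := by
  obtain ⟨T, hT, hTlim⟩ := exists_measurable_limit
  have key : ∀ (Υ : Measure RewiringLimits) {A}, MeasurableSet A →
      rewiringMixture Υ (T ⁻¹' A) = Υ (Subtype.val ⁻¹' A) := by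
    intro Υ A hA
    rw [rewiringMixture_apply Υ (hT hA), ← lintegral_indicator_one (measurable_subtype_coe hA)]
    refine lintegral_congr fun υ => ?_
    have hae : ∀ᵐ w ∂rewiringMeasure υ, T w = υ.1 :=
      (ae_rewiringMeasure_isRewiringLimit υ).mono fun w hw => hTlim w _ hw
    by_cases hυ : υ.1 ∈ A
    · rw [Set.indicator_of_mem (show υ ∈ Subtype.val ⁻¹' A from hυ), Pi.one_apply]
      exact (mem_ae_iff_prob_eq_one (hT hA)).1 (hae.mono fun w hw => by
        simpa only [Set.mem_preimage, hw] using hυ)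
    · rw [Set.indicator_of_notMem (show υ ∉ Subtype.val ⁻¹' A from hυ)]
      refine measure_eq_zero_iff_ae_notMem.2 (hae.mono fun w hw => ?_)
      rw [Set.mem_preimage, hw]; exact hυ
  ext s hs
  obtain ⟨A, hA, rfl⟩ := hs
  rw [← key Υ hA, ← key Υ' hA, h]

/-! ### Existence of the mixing measure -/

theorem measure_eq_of_cylinder {μ ν : Measure (RewiringMap ℕ)} [IsProbabilityMeasure μ]
    [IsProbabilityMeasure ν] (h : ∀ V, μ (cylinder V) = ν (cylinder V)) : μ = ν := by
  refine ext_of_generate_finite _ generateFrom_cylinders isPiSystem_cylinders ?_ (by simp)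
  rintro s (rfl | ⟨V, rfl⟩)
  · simp
  · exact h V

theorem tendsto_zero_of_eq_zero_on_dissociatedCylinders
    {f : (FiniteRewiringMap → Set.Icc (0 : ℝ) 1) → ℝ} (hf : Continuous f)
    (h0 : ∀ υ ∈ dissociatedCylinders, f υ = 0) (w : RewiringMap ℕ) :
    Tendsto (fun n => f (densities n w)) atTop (𝓝 0) := by
  refine tendsto_iff_ultrafilter _ _ _ |>.2 fun F hF => ?_
  obtain ⟨υ, -, hυ⟩ := isCompact_univ.ultrafilter_le_nhds (F.map fun n => densities n w) (by simp)
  have hυ : Tendsto (fun n => densities n w) F (𝓝 υ) := hυ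
  rw [← h0 υ (mem_dissociatedCylinders_of_tendsto hF hυ)]
  exact (hf.tendsto υ).comp hυ

/-- `Θ` is a limit along an ultrafilter of the laws of the densities. Where the expectations of `f`
converge, the integral against `Θ` must be their limit. -/
theorem exists_limit_law (μ : Measure (RewiringMap ℕ)) [IsProbabilityMeasure μ] :
    ∃ Θ : ProbabilityMeasure (FiniteRewiringMap → Set.Icc (0 : ℝ) 1),
      ∀ (f : (FiniteRewiringMap → Set.Icc (0 : ℝ) 1) → ℝ) (l : ℝ), Continuous f →
        Tendsto (fun n => ∫ w, f (densities n w) ∂μ) atTop (𝓝 l) → ∫ υ, f υ ∂Θ = l := by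
  let _ := TopologicalSpace.metrizableSpaceMetric (FiniteRewiringMap → Set.Icc (0 : ℝ) 1)
  let Θs : ℕ → ProbabilityMeasure (FiniteRewiringMap → Set.Icc (0 : ℝ) 1) := fun n =>
    ⟨μ.map (densities n),
      Measure.isProbabilityMeasure_map (continuous_densities n).measurable.aemeasurable⟩
  obtain ⟨Θ, -, hΘ⟩ := isCompact_univ.ultrafilter_le_nhds
    ((Ultrafilter.of (atTop : Filter ℕ)).map Θs) (by simp)
  have hΘ : Tendsto Θs (Ultrafilter.of (atTop : Filter ℕ)) (𝓝 Θ) := hΘ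
  refine ⟨Θ, fun f l hf hl => ?_⟩
  have h1 := ProbabilityMeasure.tendsto_iff_forall_integral_tendsto.1 hΘ
    (BoundedContinuousFunction.mkOfCompact ⟨f, hf⟩)
  refine tendsto_nhds_unique h1 ((hl.mono_left (Ultrafilter.of_le _)).congr fun n => ?_)
  exact (integral_map (continuous_densities n).measurable.aemeasurable
    hf.aestronglyMeasurable).symm

theorem integral_densities_tendsto_zero {μ : Measure (RewiringMap ℕ)} [IsProbabilityMeasure μ]
    {f : (FiniteRewiringMap → Set.Icc (0 : ℝ) 1) → ℝ} (hf : Continuous f)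
    (h0 : ∀ υ ∈ dissociatedCylinders, f υ = 0) :
    Tendsto (fun n => ∫ w, f (densities n w) ∂μ) atTop (𝓝 0) := by
  have := tendsto_integral_of_dominated_convergence (μ := μ)
    (F := fun n w => f (densities n w)) (f := fun _ => 0)
    (fun _ => ‖BoundedContinuousFunction.mkOfCompact ⟨f, hf⟩‖)
    (fun n => (hf.comp (continuous_densities n)).aestronglyMeasurable) (integrable_const _)
    (fun n => Eventually.of_forall fun w =>
      (BoundedContinuousFunction.mkOfCompact ⟨f, hf⟩).norm_coe_le_norm (densities n w))
    (Eventually.of_forall fun w => tendsto_zero_of_eq_zero_on_dissociatedCylinders hf h0 w)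
  simpa using this

theorem ExchangeableLaw.exists_mixture {μ : Measure (RewiringMap ℕ)} [IsProbabilityMeasure μ]
    (hμ : ExchangeableLaw μ) :
    ∃ Υ : Measure RewiringLimits, IsProbabilityMeasure Υ ∧ μ = rewiringMixture Υ := by
  let _ := TopologicalSpace.metrizableSpaceMetric (FiniteRewiringMap → Set.Icc (0 : ℝ) 1)
  obtain ⟨Θ, hΘ⟩ := exists_limit_law μ
  have hf : Continuous fun υ => Metric.infDist υ dissociatedCylinders :=
    Metric.continuous_infDist_pt _
  have h1 : ∫ υ, Metric.infDist υ dissociatedCylinders ∂Θ = 0 :=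
    hΘ _ 0 hf (integral_densities_tendsto_zero hf fun υ hυ => Metric.infDist_zero_of_mem hυ)
  rw [integral_eq_zero_iff_of_nonneg (fun υ => Metric.infDist_nonneg)
    (hf.integrable_of_hasCompactSupport (HasCompactSupport.of_compactSpace _))] at h1
  -- The distance to the empty set is zero by convention, so vanishing distance means membership
  -- only for a nonempty set. Any `w` would do; the zero array is used.
  have hne : dissociatedCylinders.Nonempty := by
    obtain ⟨υ, -, hυ⟩ := isCompact_univ.ultrafilter_le_nhds
      ((Ultrafilter.of (atTop : Filter ℕ)).map fun n =>
        densities n ⟨fun _ _ => (false, false), fun _ _ => rfl, fun _ => rfl⟩) (by simp)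
    exact ⟨υ, mem_dissociatedCylinders_of_tendsto (Ultrafilter.of_le _) hυ⟩
  have hmem : ∀ᵐ υ ∂(Θ : Measure (FiniteRewiringMap → Set.Icc (0 : ℝ) 1)),
      υ ∈ {υ | ∃ w : RewiringMap ℕ, IsRewiringLimit w υ} := by
    rw [← dissociatedCylinders_eq]
    filter_upwards [h1] with υ hυ
    exact (isCompact_dissociatedCylinders.isClosed.mem_iff_infDist_zero hne).2 hυ
  let Υ : Measure RewiringLimits :=
    (Θ : Measure (FiniteRewiringMap → Set.Icc (0 : ℝ) 1)).comap Subtype.val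
  have hmap : Υ.map Subtype.val = (Θ : Measure (FiniteRewiringMap → Set.Icc (0 : ℝ) 1)) := by
    refine (map_comap_subtype_coe measurableSet_setOf_isRewiringLimit _).trans ?_
    exact Measure.restrict_eq_self_of_ae_mem hmem
  have hΥ : IsProbabilityMeasure Υ := ⟨by
    rw [← Set.preimage_univ (f := (Subtype.val : RewiringLimits → _)),
      ← Measure.map_apply measurable_subtype_coe MeasurableSet.univ, hmap, measure_univ]⟩
  have : IsProbabilityMeasure (rewiringMixture Υ) := ⟨by
    rw [rewiringMixture_apply Υ MeasurableSet.univ]; simp⟩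
  refine ⟨Υ, hΥ, measure_eq_of_cylinder fun V => ?_⟩
  have hV : Continuous fun υ : FiniteRewiringMap → Set.Icc (0 : ℝ) 1 => (υ V : ℝ) :=
    continuous_subtype_val.comp (continuous_apply V)
  have h2 : ∫ υ, (υ V : ℝ) ∂(Θ : Measure (FiniteRewiringMap → Set.Icc (0 : ℝ) 1)) =
      μ.real (cylinder V) := by
    -- The expected density of `V` equals its cylinder probability once `n ≥ m`, so the sequence is
    -- eventually constant.
    refine hΘ _ _ hV (tendsto_const_nhds.congr' ?_)
    filter_upwards [eventually_ge_atTop (V.1 : ℕ)] with n hn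
    exact (hμ.integral_density V hn).symm
  rw [rewiringMixture_apply Υ (measurableSet_cylinder V), ← ofReal_measureReal, ← h2,
    ofReal_integral_eq_lintegral_ofReal
      (hV.integrable_of_hasCompactSupport (HasCompactSupport.of_compactSpace _))
      (Eventually.of_forall fun υ => (υ V).2.1), ← hmap]
  refine (lintegral_map (ENNReal.measurable_ofReal.comp hV.measurable)
    measurable_subtype_coe).trans ?_
  exact lintegral_congr fun υ => (rewiringMeasure_cylinder υ V).symm

end RewiringMap

theorem mainTheorem4 :
    CompactSpace RewiringLimits ∧
    ∀ {S : Type*} [MeasurableSpace S] (P : Measure S) [IsProbabilityMeasure P]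
      (W : S → RewiringMap ℕ), Measurable W → IsExchangeable P W →
      ∃! Υ : Measure RewiringLimits, IsProbabilityMeasure Υ ∧ P.map W = rewiringMixture Υ := by
  refine ⟨isCompact_iff_compactSpace.1 RewiringMap.isCompact_setOf_isRewiringLimit, ?_⟩
  intro S _ P _ W hW h
  have := Measure.isProbabilityMeasure_map (μ := P) hW.aemeasurable
  obtain ⟨Υ, hΥ, hmix⟩ := (h.exchangeableLaw hW).exists_mixture
  exact ⟨Υ, ⟨hΥ, hmix⟩, fun Υ' hΥ' =>
    RewiringMap.rewiringMixture_injective (hΥ'.2.symm.trans hmix)⟩
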